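/- Let $T$ be a compact Hausdorff space (for instance a compact metric space, or a finite discrete set), let $t\mapsto a_t\in\mathbb{R}^n$ be continuous on $T$, and for $b\in C(T,\mathbb{R})$ let $\mathcal{F}(b)=\{x\in\mathbb{R}^n : a_t'x\le b_t \text{ for all } t\in T\}$. Equip $\mathbb{R}^n$ with an arbitrary norm $\|\cdot\|$, with dual norm $\|u\|_*=\max_{\|x\|\le 1}|u'x|$, and $C(T,\mathbb{R})$ with the supremum norm. Distances to sets are infima, $d_*$ is the distance for $\|\cdot\|_*$, and $\inf\emptyset=+\infty$, $(+\infty)^{-1}=0$; so $d_*(0,\emptyset)^{-1}=0$. All moduli take values in $[0,+\infty]$. Fix $\bar b$ with $\mathcal{F}(\bar b)\neq\emptyset$. The Hoffman modulus $\operatorname{Hof}\mathcal{F}(\bar b)$ is the infimum of the constants $\kappa\ge 0$ such that $d(x,\mathcal{F}(\bar b))\le\kappa\, d(\bar b,\mathcal{F}^{-1}(x))$ for all $x\in\mathbb{R}^n$, where $\mathcal{F}^{-1}(x)=\{b : x\in\mathcal{F}(b)\}$; for $\bar x\in\mathcal{F}(\bar b)$, the calmness modulus $\operatorname{clm}\mathcal{F}(\bar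 b,\bar x)$ is the infimum of the $\kappa\ge0$ for which this inequality holds for all $x$ in some neighborhood of $\bar x$. For $x\in\mathcal{F}(\bar b)$ let $T(x)=\{t\in T: a_t'x=\bar b_t\}$, let $A(x)$ be the convex cone generated by $\{0\}\cup\{a_t:t\in T(x)\}$, with negative polar $A(x)^\circ=\{u : u'v\le 0 \text{ for all } v\in A(x)\}$, and let $\mathcal{D}(x)$ be the family of all $D\subset T(x)$ for which there is $d\in\mathbb{R}^n$ with $a_t'd=1$ for $t\in D$ and $a_t'd<1$ for $t\in T(x)\setminus D$. Assume that the system is locally polyhedral: for every $x\in\mathcal{F}(\bar b)$, the cone of feasible directions $\{d : \exists\,\varepsilon>0,\ x+\alpha d\in\mathcal{F}(\bar b)\text{ for all }\alpha\in[0,\varepsilon]\}$ equals $A(x)^\circ$. Let $\mathcal{E}(\bar b)$ be the set of extreme points of $\mathcal{F}(\bar b)\cap\operatorname{span}\{a_t:t\in T\}$. Then $$\operatorname{Hof}\mathcal{F}(\bar b)=\sup_{x\in\mathcal{E}(\bar b)}\operatorname{clm}\mathcal{F}(\bar b,x)=\sup_{x\in\mathcal{E}(\bar b)}\ \sup_{D\in\mathcal{D}(x)}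 d_*\big(0,\operatorname{conv}\{a_t:t\in D\}\big)^{-1}.$$ If moreover $T$ is finite, then $\mathcal{E}(\bar b)$ is finite and nonempty, $\mathcal{D}(x)$ is finite and nonempty for every $x\in\mathcal{E}(\bar b)$, and $\operatorname{Hof}\mathcal{F}(\bar b)$ is attained both as $\operatorname{clm}\mathcal{F}(\bar b,x)$ for some $x\in\mathcal{E}(\bar b)$ and as $d_*(0,\operatorname{conv}\{a_t:t\in D\})^{-1}$ for some $x\in\mathcal{E}(\bar b)$ and $D\in\mathcal{D}(x)$ (the suprema are maxima over finite sets). -/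

import Mathlib

open scoped ENNReal NNReal Topology Matrix

noncomputable section

namespace LinSys

section Multifunctions

variable {Y X : Type*} [PseudoMetricSpace Y] [PseudoMetricSpace X]

/-- Hoffman modulus of a multifunction `M : Y ⇉ X` at `y₀`: the infimum (in `[0, ∞]`) of the
constants `κ ≥ 0` such that `d(x, M y₀) ≤ κ d(y₀, M⁻¹ x)` for all `x`. -/
def hoffmanModulus (M : Y → Set X) (y₀ : Y) : ℝ≥0∞ :=
  ⨅ (κ : ℝ≥0) (_ : ∀ x : X,
    Metric.infEDist x (M y₀) ≤ (κ : ℝ≥0∞) * Metric.infEDist y₀ {y | x ∈ M y}), (κ : ℝ≥0∞)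

/-- Calmness modulus of `M : Y ⇉ X` at `(y₀, x₀)`: the infimum (in `[0, ∞]`) of the constants
`κ ≥ 0` such that `d(x, M y₀) ≤ κ d(y₀, M⁻¹ x)` for all `x` in a neighborhood of `x₀`. -/
def calmnessModulus (M : Y → Set X) (y₀ : Y) (x₀ : X) : ℝ≥0∞ :=
  ⨅ (κ : ℝ≥0) (_ : ∀ᶠ x in 𝓝 x₀,
    Metric.infEDist x (M y₀) ≤ (κ : ℝ≥0∞) * Metric.infEDist y₀ {y | x ∈ M y}), (κ : ℝ≥0∞)

end Multifunctions

section Norms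

variable {n : ℕ}

/-- The distance `(x, y) ↦ p (x - y)` on `ℝⁿ`, with its topology. It is a metric when `p` is a
norm. It is deliberately not an instance: `Fin n → ℝ` carries the metric of the maximum norm. -/
@[reducible] def normMetric (p : Seminorm ℝ (Fin n → ℝ)) : PseudoMetricSpace (Fin n → ℝ) :=
  p.toAddGroupSeminorm.toSeminormedAddCommGroup.toPseudoMetricSpace

/-- The dual norm `‖u‖_* = sup {|u'x| : p x ≤ 1}`, with values in `[0, ∞]`. -/
def dualNorm (p : Seminorm ℝ (Fin n → ℝ)) (u : Fin n → ℝ) : ℝ≥0∞ :=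
  ⨆ (x : Fin n → ℝ) (_ : p x ≤ 1), ENNReal.ofReal |u ⬝ᵥ x|

/-- The distance from `v` to `S` for the dual norm; it is `∞` if `S` is empty. -/
def dualDist (p : Seminorm ℝ (Fin n → ℝ)) (v : Fin n → ℝ) (S : Set (Fin n → ℝ)) : ℝ≥0∞ :=
  ⨅ u ∈ S, dualNorm p (v - u)

/-- The negative polar `S°`. -/
def negPolar (S : Set (Fin n → ℝ)) : Set (Fin n → ℝ) :=
  {u | ∀ x ∈ S, u ⬝ᵥ x ≤ 0}

/-- The cone of feasible directions of `C` at `x`. -/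
def feasibleDirections (C : Set (Fin n → ℝ)) (x : Fin n → ℝ) : Set (Fin n → ℝ) :=
  {d | ∃ ε > (0 : ℝ), ∀ α ∈ Set.Icc 0 ε, x + α • d ∈ C}

end Norms

section Systems

variable {n : ℕ} {T : Type*} [TopologicalSpace T]

/-- The feasible set mapping `F(b) = {x : a_t' x ≤ b_t for all t ∈ T}`. -/
def feasibleSet (a : C(T, Fin n → ℝ)) (b : C(T, ℝ)) : Set (Fin n → ℝ) :=
  {x | ∀ t, a t ⬝ᵥ x ≤ b t}

/-- The set `T(x)` of active indices. -/
def activeIndices (a : C(T, Fin n → ℝ)) (b : C(T, ℝ)) (x : Fin n → ℝ) : Set T :=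
  {t | a t ⬝ᵥ x = b t}

/-- The active cone `A(x) = cone {a_t : t ∈ T(x)}`; it contains `0`. -/
def activeCone (a : C(T, Fin n → ℝ)) (b : C(T, ℝ)) (x : Fin n → ℝ) : Set (Fin n → ℝ) :=
  (Submodule.span ℝ≥0 (a '' activeIndices a b x) : Set (Fin n → ℝ))

/-- The system `{a_t' x ≤ b_t, t ∈ T}` is locally polyhedral. -/
def IsLOP (a : C(T, Fin n → ℝ)) (b : C(T, ℝ)) : Prop :=
  ∀ x ∈ feasibleSet a b,
    feasibleDirections (feasibleSet a b) x = negPolar (activeCone a b x)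

/-- The family `𝒟(x)` of the sets `D ⊆ T(x)` for which some `d` satisfies `a_t' d = 1` for `t ∈ D`
and `a_t' d < 1` for `t ∈ T(x) \ D`. -/
def hyperplaneFamily (a : C(T, Fin n → ℝ)) (b : C(T, ℝ)) (x : Fin n → ℝ) : Set (Set T) :=
  {D | D ⊆ activeIndices a b x ∧ ∃ d : Fin n → ℝ,
    (∀ t ∈ D, a t ⬝ᵥ d = 1) ∧ ∀ t ∈ activeIndices a b x \ D, a t ⬝ᵥ d < 1}

/-- The set `E(b)` of extreme points of `F(b) ∩ span {a_t : t ∈ T}`. -/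
def extremeSet (a : C(T, Fin n → ℝ)) (b : C(T, ℝ)) : Set (Fin n → ℝ) :=
  Set.extremePoints ℝ (feasibleSet a b ∩ (Submodule.span ℝ (Set.range a) : Set (Fin n → ℝ)))

variable [CompactSpace T]

/-- `Hof F(b)`, with `C(T, ℝ)` under the supremum norm and `ℝⁿ` under the norm `p`. -/
def hofF (p : Seminorm ℝ (Fin n → ℝ)) (a : C(T, Fin n → ℝ)) (b : C(T, ℝ)) : ℝ≥0∞ :=
  @hoffmanModulus C(T, ℝ) (Fin n → ℝ) _ (normMetric p) (feasibleSet a) b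

/-- `clm F(b, x)`, with `C(T, ℝ)` under the supremum norm and `ℝⁿ` under the norm `p`. -/
def clmF (p : Seminorm ℝ (Fin n → ℝ)) (a : C(T, Fin n → ℝ)) (b : C(T, ℝ))
    (x : Fin n → ℝ) : ℝ≥0∞ :=
  @calmnessModulus C(T, ℝ) (Fin n → ℝ) _ (normMetric p) (feasibleSet a) b x

end Systems

end LinSys

/-!
Lower bound. Let `q ∈ conv {a_t : t ∈ D}` for a set `D ∈ 𝒟(e)` with direction `d`. Every feasible
`y` satisfies `q'(e + sd - y) ≥ s`, so `e + sd` is at distance at least `s / ‖q‖_*` from `F(b)`,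
while for small `s > 0` it violates no constraint by more than `s(1 + δ)`. Letting `δ → 0`, this
bounds the calmness modulus at `e` from below by `1 / ‖q‖_*`.

Upper bound. Scale the norm so that every such `q`, at every extreme point, has dual norm greater
than `1`. Let `y` be a feasible point nearest to `x`, and let `e` be an extreme point with
`T(y) ⊆ T(e)`; there is one, because no line lies in the face of `F(b) ∩ span {a_t}` on which the
constraints in `T(y)` are active. If `x` violates no constraint by more than `M`, then
`a_t'(x - e) ≤ M` on `T(e)`. Minimise `m + p(w - (x - e))` over `m ≥ 0` and `w` with `a_t'w ≤ m`
on `T(e)`. A minimiser has `m = 0`: otherwise the `t` with `a_t'w = m` form a member of `𝒟(e)`,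
with direction `w / m`, and by separation some `v` with `p v < 1` has `a_t'v > 1` for all of them,
so that a small step along `-v` lowers the objective. Hence `p(w - (x - e)) ≤ M` for some `w` with
`a_t'w ≤ 0` on `T(e)`. By local polyhedrality `e + w - y` is a feasible direction at `y`, and since
`y` is a nearest point, `p(x - y) ≤ p(x - (e + w)) ≤ M`.
-/

namespace LinSys

section Compactness

variable {X : Type*} [TopologicalSpace X]

theorem eventually_forall_add_mul_neg {K : Set X} (hK : IsCompact K) {g h : X → ℝ}
    (hg : Continuous g) (hh : Continuous h) (hgK : ∀ x ∈ K, g x ≤ 0)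
    (hhK : ∀ x ∈ K, g x = 0 → h x < 0) :
    ∀ᶠ r in 𝓝[>] (0 : ℝ), ∀ x ∈ K, g x + r * h x < 0 := by
  suffices ∀ᶠ r in 𝓝 (0 : ℝ), ∀ x ∈ K, x ∈ K → 0 < r → g x + r * h x < 0 by
    filter_upwards [this.filter_mono nhdsWithin_le_nhds, self_mem_nhdsWithin] with r hr hpos x hx
    exact hr x hx hx hpos
  refine hK.eventually_forall_of_forall_eventually fun x hx => ?_
  rcases (hgK x hx).lt_or_eq with hneg | hzero
  · have hcont : Continuous fun z : ℝ × X => g z.2 + z.1 * h z.2 := by fun_prop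
    have hlt : g x + 0 * h x < 0 := by simpa using hneg
    filter_upwards [hcont.continuousAt.eventually_lt_const hlt] with z hz _ _ using hz
  · have hcont : Continuous fun z : ℝ × X => h z.2 := by fun_prop
    filter_upwards [hcont.continuousAt.eventually_lt_const (hhK x hx hzero)] with z hz hzK hpos
    exact add_neg_of_nonpos_of_neg (hgK z.2 hzK) (mul_neg_of_pos_of_neg hpos hz)

end Compactness

section Faces

variable {E : Type*} [AddCommGroup E] [Module ℝ E] {C : Set E} {y z : E}

/-- The direction of the smallest face of the convex set `C` that contains the point `z`, encoded
as the space of the vectors along which `z` can be moved a little both ways inside `C`. Extreme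
points are found by minimising it. -/
def faceDirection (hC : Convex ℝ C) (hz : z ∈ C) : Submodule ℝ E where
  carrier := {w | ∀ᶠ s in 𝓝 (0 : ℝ), z + s • w ∈ C}
  zero_mem' := by simp [hz]
  add_mem' {v w} hv hw := by
    have hlim : Filter.Tendsto (fun s : ℝ => 2 * s) (𝓝 0) (𝓝 0) :=
      Continuous.tendsto' (by fun_prop) _ _ (mul_zero 2)
    filter_upwards [hlim.eventually hv, hlim.eventually hw] with s hv hw
    convert hC.midpoint_mem hv hw using 1
    rw [midpoint_eq_smul_add, invOf_eq_inv]
    module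
  smul_mem' c w hw := by
    have hlim : Filter.Tendsto (fun s : ℝ => s * c) (𝓝 0) (𝓝 0) :=
      Continuous.tendsto' (by fun_prop) _ _ (zero_mul c)
    filter_upwards [hlim.eventually hw] with s hs
    rwa [smul_smul]

theorem mem_faceDirection {hC : Convex ℝ C} {hz : z ∈ C} {w : E} :
    w ∈ faceDirection hC hz ↔ ∀ᶠ s in 𝓝 (0 : ℝ), z + s • w ∈ C :=
  Iff.rfl

theorem exists_pos_of_mem_faceDirection {hC : Convex ℝ C} {hz : z ∈ C} {w : E}
    (hw : w ∈ faceDirection hC hz) : ∃ ε > (0 : ℝ), z + ε • w ∈ C ∧ z - ε • w ∈ C := by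
  have hboth := (mem_faceDirection.1 hw).and (mem_faceDirection.1 (neg_mem hw))
  obtain ⟨ε, hmem, hε⟩ :=
    ((hboth.filter_mono nhdsWithin_le_nhds).and (self_mem_nhdsWithin (s := Set.Ioi 0))).exists
  exact ⟨ε, hε, by simpa only [smul_neg, ← sub_eq_add_neg] using hmem⟩

theorem faceDirection_le_of_mem_openSegment (hC : Convex ℝ C) (hz : z ∈ C) {u v : E} (hu : u ∈ C)
    (hv : v ∈ C) (hzuv : z ∈ openSegment ℝ u v) : faceDirection hC hu ≤ faceDirection hC hz := by
  obtain ⟨α, β, hα, hβ, hαβ, rfl⟩ := hzuv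
  intro w hw
  have hlim : Filter.Tendsto (fun s : ℝ => s / α) (𝓝 0) (𝓝 0) :=
    Continuous.tendsto' (by fun_prop) _ _ (zero_div α)
  refine mem_faceDirection.2 ?_
  filter_upwards [hlim.eventually (mem_faceDirection.1 hw)] with s hs
  convert hC hs hv hα.le hβ.le hαβ using 1
  rw [smul_add, smul_smul, mul_div_cancel₀ s hα.ne', add_right_comm]

theorem sub_mem_faceDirection (hC : Convex ℝ C) (hz : z ∈ C) {u v : E} (hu : u ∈ C) (hv : v ∈ C)
    (hzuv : z ∈ openSegment ℝ u v) : v - u ∈ faceDirection hC hz := by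
  obtain ⟨α, β, hα, hβ, hαβ, rfl⟩ := hzuv
  refine mem_faceDirection.2 ?_
  filter_upwards [Icc_mem_nhds (neg_lt_zero.2 hβ) hα] with s hs
  convert hC hu hv (sub_nonneg.2 hs.2) (neg_le_iff_add_nonneg'.1 hs.1) (by linarith) using 1
  module

theorem mem_extremePoints_iff_faceDirection_eq_bot (hC : Convex ℝ C) (hz : z ∈ C) :
    z ∈ C.extremePoints ℝ ↔ faceDirection hC hz = ⊥ := by
  refine ⟨fun hext => (Submodule.eq_bot_iff _).2 fun w hw => ?_,
    fun hbot => ⟨hz, fun u hu v hv hzuv => ?_⟩⟩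
  · obtain ⟨ε, hε, hplus, hminus⟩ := exists_pos_of_mem_faceDirection hw
    have hseg : z ∈ openSegment ℝ (z + ε • w) (z - ε • w) :=
      ⟨1 / 2, 1 / 2, by norm_num, by norm_num, by norm_num, by module⟩
    have hzero : ε • w = 0 := by simpa using hext.2 hplus hminus hseg
    exact (smul_eq_zero.1 hzero).resolve_left hε.ne'
  · have hmem := sub_mem_faceDirection hC hz hu hv hzuv
    rw [hbot, Submodule.mem_bot, sub_eq_zero] at hmem
    subst hmem
    rw [openSegment_same, Set.mem_singleton_iff] at hzuv
    exact hzuv.symm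

variable [TopologicalSpace E] [ContinuousAdd E] [ContinuousSMul ℝ E]

theorem exists_faceDirection_lt (hC : Convex ℝ C) (hclosed : IsClosed C) (hz : z ∈ C) {w : E}
    (hw : w ∈ faceDirection hC hz) {r : ℝ} (hr : 0 ≤ r) (hout : z + r • w ∉ C) :
    ∃ u, ∃ hu : u ∈ C, faceDirection hC hu < faceDirection hC hz := by
  let I : Set ℝ := {s | z + s • w ∈ C}
  have hIclosed : IsClosed I := hclosed.preimage (by fun_prop)
  have hIconvex : Convex ℝ I :=
    hC.affine_preimage (AffineMap.const ℝ ℝ z + (LinearMap.toSpanSingleton ℝ E w).toAffineMap)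
  have hIzero : (0 : ℝ) ∈ I := by simpa [I] using hz
  have hIle : ∀ s ∈ I, s ≤ r := fun s hs => by
    by_contra! hrs
    exact hout (hIconvex.ordConnected.out hIzero hs ⟨hr, hrs.le⟩)
  obtain ⟨m, hm⟩ : ∃ m, IsGreatest I m :=
    ⟨sSup I, hIclosed.isGreatest_csSup ⟨0, hIzero⟩ ⟨r, hIle⟩⟩
  have hwm : w ∉ faceDirection hC hm.1 := fun hmem => by
    obtain ⟨ε, hε, hplus, -⟩ := exists_pos_of_mem_faceDirection hmem
    rw [add_assoc, ← add_smul] at hplus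
    exact (lt_add_of_pos_right m hε).not_ge (hm.2 hplus)
  obtain ⟨ε, hε, hplus, hminus⟩ := exists_pos_of_mem_faceDirection hw
  have hmpos : 0 < m := hε.trans_le (hm.2 hplus)
  have hseg : z ∈ openSegment ℝ (z + m • w) (z - ε • w) :=
    ⟨ε / (m + ε), m / (m + ε), by positivity, by positivity, by field_simp; ring, by
      match_scalars <;> field_simp <;> ring⟩
  exact ⟨z + m • w, hm.1, (faceDirection_le_of_mem_openSegment hC hz hm.1 hminus hseg).lt_of_not_ge
    fun hle => hwm (hle hw)⟩

theorem nonempty_extremePoints_of_forall_line [FiniteDimensional ℝ E] (hC : Convex ℝ C)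
    (hclosed : IsClosed C) (hne : C.Nonempty)
    (hline : ∀ z ∈ C, ∀ w : E, (∀ s : ℝ, z + s • w ∈ C) → w = 0) :
    (C.extremePoints ℝ).Nonempty := by
  have := hne.to_subtype
  let z : C := Function.argmin fun z : C => faceDirection hC z.2
  have hmin : ∀ u (hu : u ∈ C), ¬faceDirection hC hu < faceDirection hC z.2 := fun u hu =>
    Function.not_lt_argmin (fun z : C => faceDirection hC z.2) ⟨u, hu⟩
  refine ⟨z, (mem_extremePoints_iff_faceDirection_eq_bot hC z.2).2 ?_⟩
  refine (Submodule.eq_bot_iff _).2 fun w hw => hline z z.2 w fun s => ?_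
  by_contra hout
  rcases le_total 0 s with hs | hs
  · obtain ⟨u, hu, hlt⟩ := exists_faceDirection_lt hC hclosed z.2 hw hs hout
    exact hmin u hu hlt
  · obtain ⟨u, hu, hlt⟩ := exists_faceDirection_lt hC hclosed z.2 (neg_mem hw)
      (neg_nonneg.2 hs) (by rwa [neg_smul_neg])
    exact hmin u hu hlt

end Faces

section ConvexHull

variable {E : Type*} [AddCommGroup E] [Module ℝ E] [FiniteDimensional ℝ E]

theorem exists_fin_sum_smul_eq_of_mem_convexHull {S : Set E} {x : E}
    (hx : x ∈ convexHull ℝ S) :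
    ∃ w ∈ stdSimplex ℝ (Fin (Module.finrank ℝ E + 1)),
      ∃ z : Fin (Module.finrank ℝ E + 1) → E, (∀ i, z i ∈ S) ∧ ∑ i, w i • z i = x := by
  obtain ⟨s₀, hs₀⟩ := convexHull_nonempty_iff.1 ⟨x, hx⟩
  obtain ⟨J, _, z, w, hzS, hzind, hwpos, hwsum, hwz⟩ := eq_pos_convex_span_of_mem_convexHull hx
  have hcard : Fintype.card J ≤ Fintype.card (Fin (Module.finrank ℝ E + 1)) := by
    rw [Fintype.card_fin]
    exact hzind.card_le_finrank_succ.trans (by gcongr; exact Submodule.finrank_le _)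
  obtain ⟨f⟩ := Function.Embedding.nonempty_of_card_le hcard
  have hw : ∀ j, Function.extend f w (fun _ => 0) (f j) = w j := f.injective.extend_apply w _
  have hz : ∀ j, Function.extend f z (fun _ => s₀) (f j) = z j := f.injective.extend_apply z _
  have hw0 : ∀ i ∉ Set.range f, Function.extend f w (fun _ => 0) i = 0 := fun i hi =>
    Function.extend_apply' w _ i hi
  refine ⟨Function.extend f w fun _ => 0, ⟨fun i => ?_, ?_⟩, Function.extend f z fun _ => s₀,
    fun i => ?_, ?_⟩
  · by_cases hi : i ∈ Set.range f
    · obtain ⟨j, rfl⟩ := hi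
      exact (hwpos j).le.trans_eq (hw j).symm
    · exact (hw0 i hi).ge
  · exact (Fintype.sum_of_injective f f.injective w _ hw0 fun j => (hw j).symm).symm.trans hwsum
  · by_cases hi : i ∈ Set.range f
    · obtain ⟨j, rfl⟩ := hi
      exact hz j ▸ hzS ⟨j, rfl⟩
    · rwa [Function.extend_apply' _ _ _ hi]
  · rw [← hwz]
    refine (Fintype.sum_of_injective f f.injective _ _ (fun i hi => ?_) fun j => ?_).symm
    · rw [hw0 i hi, zero_smul]
    · rw [hw, hz]

variable [TopologicalSpace E] [ContinuousAdd E] [ContinuousSMul ℝ E]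

theorem isCompact_convexHull {S : Set E} (hS : IsCompact S) : IsCompact (convexHull ℝ S) := by
  let ι := Fin (Module.finrank ℝ E + 1)
  have himage : (fun v : (ι → ℝ) × (ι → E) => ∑ i, v.1 i • v.2 i) ''
      (stdSimplex ℝ ι ×ˢ Set.univ.pi fun _ => S) = convexHull ℝ S := by
    refine Set.Subset.antisymm ?_ fun x hx => ?_
    · rintro _ ⟨v, ⟨hw, hz⟩, rfl⟩
      exact (convex_convexHull ℝ S).sum_mem (fun i _ => hw.1 i) hw.2 fun i _ =>
        subset_convexHull ℝ S (hz i trivial)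
    · obtain ⟨w, hw, z, hz, rfl⟩ := exists_fin_sum_smul_eq_of_mem_convexHull hx
      exact ⟨(w, z), ⟨hw, fun i _ => hz i⟩, rfl⟩
  rw [← himage]
  exact ((isCompact_stdSimplex ℝ ι).prod (isCompact_univ_pi fun _ => hS)).image (by fun_prop)

end ConvexHull

section Seminorms

theorem exists_dual_eq_seminorm {E : Type*} [AddCommGroup E] [Module ℝ E] (p : Seminorm ℝ E)
    (x : E) : ∃ f : Module.Dual ℝ E, f x = p x ∧ ∀ y, f y ≤ p y := by
  let _ : SeminormedAddCommGroup E := p.toAddGroupSeminorm.toSeminormedAddCommGroup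
  let _ : NormedSpace ℝ E := ⟨fun c x => (map_smul_eq_mul p c x).le⟩
  obtain ⟨f, hf, hfx⟩ := exists_dual_vector'' ℝ x
  refine ⟨f, hfx, fun y => (le_abs_self (f y)).trans ?_⟩
  exact (f.le_of_opNorm_le hf y).trans_eq (one_mul (p y))

variable {E : Type*} [NormedAddCommGroup E] [NormedSpace ℝ E] [FiniteDimensional ℝ E]
  (p : Seminorm ℝ E)

theorem continuous_seminorm : Continuous p :=
  continuousOn_univ.1 (p.convexOn.continuousOn isOpen_univ)

variable {p}

theorem exists_pos_forall_mul_norm_le (hp : ∀ x, p x = 0 → x = 0) :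
    ∃ c > 0, ∀ x, c * ‖x‖ ≤ p x := by
  have hpos : ∀ x ∈ Metric.sphere (0 : E) 1, 0 < p x := fun x hx =>
    (apply_nonneg p x).lt_of_ne fun h => Metric.ne_of_mem_sphere hx one_ne_zero (hp x h.symm)
  have := FiniteDimensional.proper_real E
  obtain ⟨c, hc, hle⟩ :=
    (isCompact_sphere (0 : E) 1).exists_forall_le' (continuous_seminorm p).continuousOn hpos
  refine ⟨c, hc, fun x => ?_⟩
  rcases eq_or_ne x 0 with rfl | hx
  · simp
  have hunit := hle (‖x‖⁻¹ • x) (by simp [norm_smul, hx])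
  rwa [map_smul_eq_mul, norm_inv, norm_norm, ← div_eq_inv_mul,
    le_div_iff₀ (norm_pos_iff.2 hx)] at hunit

theorem isCompact_closedBall_seminorm (hp : ∀ x, p x = 0 → x = 0) (x : E) (r : ℝ) :
    IsCompact (p.closedBall x r) := by
  obtain ⟨c, hc, hle⟩ := exists_pos_forall_mul_norm_le hp
  have := FiniteDimensional.proper_real E
  have hcont := continuous_seminorm p
  have hclosed : IsClosed (p.closedBall x r) :=
    isClosed_le (hcont.comp (continuous_id.sub continuous_const)) continuous_const
  refine (isCompact_closedBall x (r / c)).of_isClosed_subset hclosed fun y hy => ?_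
  rw [mem_closedBall_iff_norm, le_div_iff₀ hc, mul_comm]
  exact (hle _).trans (p.mem_closedBall.1 hy)

theorem exists_forall_seminorm_sub_le (hp : ∀ x, p x = 0 → x = 0) {F : Set E} (hF : IsClosed F)
    (hne : F.Nonempty) (x : E) : ∃ y ∈ F, ∀ z ∈ F, p (x - y) ≤ p (x - z) := by
  obtain ⟨z₀, hz₀⟩ := hne
  have hcont : Continuous fun z => p (x - z) := (continuous_seminorm p).comp (by fun_prop)
  have hcompact : IsCompact (F ∩ p.closedBall x (p (x - z₀))) :=
    (isCompact_closedBall_seminorm hp x _).inter_left hF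
  have hmem : ∀ z, z ∈ p.closedBall x (p (x - z₀)) ↔ p (x - z) ≤ p (x - z₀) := fun z => by
    rw [p.mem_closedBall, map_sub_rev]
  obtain ⟨y, hy, hmin⟩ := hcompact.exists_isMinOn ⟨z₀, hz₀, (hmem z₀).2 le_rfl⟩ hcont.continuousOn
  refine ⟨y, hy.1, fun z hz => ?_⟩
  rcases le_total (p (x - z)) (p (x - z₀)) with hle | hle
  · exact hmin ⟨hz, (hmem z).2 hle⟩
  · exact ((hmem y).1 hy.2).trans hle

end Seminorms

section ErrorBound

variable {ι : Type*} [Fintype ι] {p : Seminorm ℝ (ι → ℝ)} {S : Set (ι → ℝ)}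

-- The hypothesis `hconv` says that all points of `conv S` have dual norm greater than `1`, without
-- a reference to the dual norm.
theorem exists_forall_lt_dotProduct (hS : IsCompact S)
    (hconv : ∀ q ∈ convexHull ℝ S, ∃ x, p x < q ⬝ᵥ x) :
    ∃ x γ, p x < γ ∧ ∀ s ∈ S, γ < s ⬝ᵥ x := by
  classical
  let B : Set (ι → ℝ) := {u | ∀ x, u ⬝ᵥ x ≤ p x}
  have hBclosed : IsClosed B := by
    simp only [B, Set.ofPred_forall]
    exact isClosed_iInter fun x => isClosed_le (by fun_prop) continuous_const
  have hBconvex : Convex ℝ B := by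
    simp only [B, Set.ofPred_forall]
    exact convex_iInter fun x =>
      convex_halfSpace_le ((dotProductEquiv ℝ ι).toLinearMap.flip x).isLinear (p x)
  have hdisjoint : Disjoint (convexHull ℝ S) B := Set.disjoint_left.2 fun q hq hqB => by
    obtain ⟨x, hx⟩ := hconv q hq
    exact (hqB x).not_gt hx
  obtain ⟨f, α, β, hfS, hαβ, hfB⟩ := geometric_hahn_banach_compact_closed
    (convex_convexHull ℝ S) (isCompact_convexHull hS) hBconvex hBclosed hdisjoint
  obtain ⟨x, hx⟩ := (dotProductEquiv ℝ ι).surjective (-f : StrongDual ℝ (ι → ℝ))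
  have hxf : ∀ u, u ⬝ᵥ x = -f u := fun u => by
    rw [dotProduct_comm]
    exact LinearMap.congr_fun hx u
  obtain ⟨g, hgx, hgp⟩ := exists_dual_eq_seminorm p x
  obtain ⟨u, rfl⟩ := (dotProductEquiv ℝ ι).surjective g
  refine ⟨x, -α, ?_, fun s hs => ?_⟩
  · rw [← hgx, dotProductEquiv_apply_apply, hxf]
    linarith [hfB u hgp]
  · rw [hxf]
    linarith [hfS s (subset_convexHull ℝ S hs)]

theorem exists_add_seminorm_sub_lt (hS : IsCompact S)
    (hface : ∀ d, (∀ s ∈ S, s ⬝ᵥ d ≤ 1) →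
      ∀ q ∈ convexHull ℝ {s ∈ S | s ⬝ᵥ d = 1}, ∃ x, p x < q ⬝ᵥ x)
    {w : ι → ℝ} {m : ℝ} (hm : 0 < m) (hw : ∀ s ∈ S, s ⬝ᵥ w ≤ m) :
    ∃ w' m', 0 ≤ m' ∧ (∀ s ∈ S, s ⬝ᵥ w' ≤ m') ∧ m' + p (w' - w) < m := by
  have hd : ∀ s, s ⬝ᵥ (m⁻¹ • w) = s ⬝ᵥ w / m := fun s => by
    rw [dotProduct_smul, smul_eq_mul, inv_mul_eq_div]
  have hfaceclosed : IsClosed {s : ι → ℝ | s ⬝ᵥ (m⁻¹ • w) = 1} :=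
    isClosed_eq (by fun_prop) continuous_const
  obtain ⟨x, γ, hpx, hγ⟩ := exists_forall_lt_dotProduct (hS.inter_right hfaceclosed)
    (hface (m⁻¹ • w) fun s hs => (hd s).trans_le ((div_le_one hm).2 (hw s hs)))
  have hγpos : 0 < γ := (apply_nonneg p x).trans_lt hpx
  have hsmall := eventually_forall_add_mul_neg hS (g := fun s => s ⬝ᵥ w - m)
    (h := fun s => γ - s ⬝ᵥ x) (by fun_prop) (by fun_prop) (fun s hs => sub_nonpos.2 (hw s hs))
    fun s hs h0 => sub_neg.2 <| hγ s ⟨hs, (hd s).trans (by rw [sub_eq_zero.1 h0, div_self hm.ne'])⟩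
  obtain ⟨r, hr, hrpos, hrm⟩ := (hsmall.and (Ioo_mem_nhdsGT (div_pos hm hγpos))).exists
  rw [lt_div_iff₀ hγpos] at hrm
  refine ⟨w - r • x, m - r * γ, (sub_pos.2 hrm).le, fun s hs => ?_, ?_⟩
  · rw [dotProduct_sub, dotProduct_smul, smul_eq_mul]
    linarith [hr s hs]
  · rw [sub_sub_cancel_left, map_neg_eq_map, map_smul_eq_mul, Real.norm_of_nonneg hrpos.le]
    linarith [mul_lt_mul_of_pos_left hpx hrpos]

theorem exists_forall_dotProduct_nonpos_seminorm_sub_le (hp : ∀ x, p x = 0 → x = 0)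
    (hS : IsCompact S)
    (hface : ∀ d, (∀ s ∈ S, s ⬝ᵥ d ≤ 1) →
      ∀ q ∈ convexHull ℝ {s ∈ S | s ⬝ᵥ d = 1}, ∃ x, p x < q ⬝ᵥ x)
    {z : ι → ℝ} {M : ℝ} (hM : 0 ≤ M) (hz : ∀ s ∈ S, s ⬝ᵥ z ≤ M) :
    ∃ w, (∀ s ∈ S, s ⬝ᵥ w ≤ 0) ∧ p (w - z) ≤ M := by
  have hcont : Continuous fun v : (ι → ℝ) × ℝ => v.2 + p (v.1 - z) :=
    continuous_snd.add ((continuous_seminorm p).comp (by fun_prop))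
  let Q : Set ((ι → ℝ) × ℝ) := {v | 0 ≤ v.2 ∧ (∀ s ∈ S, s ⬝ᵥ v.1 ≤ v.2) ∧ v.2 + p (v.1 - z) ≤ M}
  have hQclosed : IsClosed Q := by
    simp only [Q, Set.ofPred_and, Set.ofPred_forall]
    exact (isClosed_le continuous_const continuous_snd).inter
      ((isClosed_biInter fun s _ => isClosed_le (by fun_prop) continuous_snd).inter
        (isClosed_le hcont continuous_const))
  have hQcompact : IsCompact Q := by
    refine ((isCompact_closedBall_seminorm hp z M).prod (isCompact_Icc (a := 0) (b := M)))
      |>.of_isClosed_subset hQclosed fun v ⟨hv0, _, hvM⟩ => ⟨p.mem_closedBall.2 ?_, hv0, ?_⟩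
    · linarith
    · linarith [apply_nonneg p (v.1 - z)]
  obtain ⟨⟨w, m⟩, ⟨hm, hw, hwM⟩, hmin⟩ :=
    hQcompact.exists_isMinOn ⟨(z, M), hM, hz, by simp⟩ hcont.continuousOn
  rcases hm.eq_or_lt with hzero | hpos
  · rw [← hzero] at hw hwM
    exact ⟨w, hw, by simpa using hwM⟩
  · obtain ⟨w', m', hm', hw', hlt⟩ := exists_add_seminorm_sub_lt hS hface hpos hw
    have htriangle : p (w' - z) ≤ p (w' - w) + p (w - z) := le_map_sub_add_map_sub p w' w z
    have hdecrease : m' + p (w' - z) < m + p (w - z) := by linarith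
    have hmem : (w', m') ∈ Q := ⟨hm', hw', hdecrease.le.trans hwM⟩
    have hminimal : m + p (w - z) ≤ m' + p (w' - z) := hmin hmem
    exact (hdecrease.not_ge hminimal).elim

end ErrorBound

section DotProduct

variable {ι : Type*} [Fintype ι]

theorem dotProduct_eq_of_mem_span {R : Type*} [Semiring R] {S : Set (ι → R)} {x y v : ι → R}
    (h : ∀ s ∈ S, s ⬝ᵥ x = s ⬝ᵥ y) (hv : v ∈ Submodule.span R S) : v ⬝ᵥ x = v ⬝ᵥ y := by
  induction hv using Submodule.span_induction with
  | mem s hs => exact h s hs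
  | zero => rw [zero_dotProduct, zero_dotProduct]
  | add u v _ _ hu hv => rw [add_dotProduct, add_dotProduct, hu, hv]
  | smul c v _ hv => rw [smul_dotProduct, smul_dotProduct, hv]

theorem dotProduct_nonpos_of_mem_span {S : Set (ι → ℝ)} {w v : ι → ℝ} (h : ∀ s ∈ S, s ⬝ᵥ w ≤ 0)
    (hv : v ∈ Submodule.span ℝ≥0 S) : v ⬝ᵥ w ≤ 0 := by
  induction hv using Submodule.span_induction with
  | mem s hs => exact h s hs
  | zero => rw [zero_dotProduct]
  | add u v _ _ hu hv => exact (add_dotProduct u v w).trans_le (add_nonpos hu hv)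
  | smul c v _ hv => exact (smul_dotProduct c v w).trans_le (smul_nonpos_of_nonneg_of_nonpos c.2 hv)

theorem exists_mem_forall_dotProduct_eq (V : Submodule ℝ (ι → ℝ)) (x : ι → ℝ) :
    ∃ y ∈ V, ∀ v ∈ V, v ⬝ᵥ y = v ⬝ᵥ x := by
  classical
  let f : V →ₗ[ℝ] Module.Dual ℝ V :=
    V.dualRestrict ∘ₗ (dotProductEquiv ℝ ι).toLinearMap ∘ₗ V.subtype
  have hf : Function.Injective f := (injective_iff_map_eq_zero f).2 fun y hy =>
    Subtype.ext (dotProduct_self_eq_zero.1 (LinearMap.congr_fun hy y))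
  obtain ⟨y, hy⟩ := (LinearMap.injective_iff_surjective_of_finrank_eq_finrank
    (Subspace.dual_finrank_eq (K := ℝ) (V := V)).symm).1 hf (V.dualRestrict (dotProductEquiv ℝ ι x))
  refine ⟨y, y.2, fun v hv => ?_⟩
  rw [dotProduct_comm v, dotProduct_comm v]
  exact LinearMap.congr_fun hy ⟨v, hv⟩

end DotProduct

section FeasibleSet

variable {n : ℕ}

theorem seminorm_sub_le_of_mem_feasibleDirections {p : Seminorm ℝ (Fin n → ℝ)}
    {F : Set (Fin n → ℝ)} {x y v : Fin n → ℝ} (hy : ∀ z ∈ F, p (x - y) ≤ p (x - z))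
    (hv : v ∈ feasibleDirections F y) : p (x - y) ≤ p (x - (y + v)) := by
  obtain ⟨ε, hε, hmem⟩ := hv
  set r := min ε 1
  have hr : 0 < r := lt_min hε one_pos
  have hr1 : 0 ≤ 1 - r := sub_nonneg.2 (min_le_right ε 1)
  have hcomb : x - (y + r • v) = (1 - r) • (x - y) + r • (x - (y + v)) := by module
  have hle : p (x - y) ≤ (1 - r) * p (x - y) + r * p (x - (y + v)) :=
    calc p (x - y) ≤ p (x - (y + r • v)) := hy _ (hmem r ⟨hr.le, min_le_left ε 1⟩)
      _ ≤ (1 - r) * p (x - y) + r * p (x - (y + v)) := by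
        rw [hcomb]
        refine (map_add_le_add p _ _).trans_eq ?_
        rw [map_smul_eq_mul, map_smul_eq_mul, Real.norm_of_nonneg hr1, Real.norm_of_nonneg hr.le]
  exact le_of_mul_le_mul_left (by linarith) hr

variable {T : Type*} [TopologicalSpace T] {a : C(T, Fin n → ℝ)} {b : C(T, ℝ)}

theorem isClosed_feasibleSet (a : C(T, Fin n → ℝ)) (b : C(T, ℝ)) :
    IsClosed (feasibleSet a b) := by
  simp only [feasibleSet, Set.ofPred_forall]
  exact isClosed_iInter fun t => isClosed_le (by fun_prop) continuous_const

theorem convex_feasibleSet (a : C(T, Fin n → ℝ)) (b : C(T, ℝ)) : Convex ℝ (feasibleSet a b) := by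
  simp only [feasibleSet, Set.ofPred_forall]
  exact convex_iInter fun t => convex_halfSpace_le (dotProductEquiv ℝ (Fin n) (a t)).isLinear (b t)

theorem isCompact_image_activeIndices [CompactSpace T] (a : C(T, Fin n → ℝ)) (b : C(T, ℝ))
    (x : Fin n → ℝ) : IsCompact (a '' activeIndices a b x) := by
  have hclosed : IsClosed (activeIndices a b x) :=
    isClosed_eq (a.continuous.dotProduct continuous_const) b.continuous
  exact hclosed.isCompact.image a.continuous

theorem empty_mem_hyperplaneFamily (a : C(T, Fin n → ℝ)) (b : C(T, ℝ)) (x : Fin n → ℝ) :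
    ∅ ∈ hyperplaneFamily a b x :=
  ⟨Set.empty_subset _, 0, fun _ ht => ht.elim, fun t _ => by simp⟩

theorem dotProduct_eq_zero_of_forall_add_smul_mem {x w : Fin n → ℝ}
    (h : ∀ s : ℝ, x + s • w ∈ feasibleSet a b) (t : T) : a t ⬝ᵥ w = 0 := by
  by_contra hne
  have hle : a t ⬝ᵥ (x + ((b t - a t ⬝ᵥ x + 1) / a t ⬝ᵥ w) • w) ≤ b t := h _ t
  rw [dotProduct_add, dotProduct_smul, smul_eq_mul, div_mul_cancel₀ _ hne] at hle
  linarith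

theorem le_dotProduct_of_mem_convexHull {D : Set T} {e d q : Fin n → ℝ}
    (hD : D ⊆ activeIndices a b e) (hd : ∀ t ∈ D, a t ⬝ᵥ d = 1)
    (hq : q ∈ convexHull ℝ (a '' D)) {y : Fin n → ℝ} (hy : y ∈ feasibleSet a b) (s : ℝ) :
    s ≤ q ⬝ᵥ (e + s • d - y) := by
  have hconv : Convex ℝ {u : Fin n → ℝ | s ≤ u ⬝ᵥ (e + s • d - y)} := by
    simp only [dotProduct_comm _ (e + s • d - y)]
    exact convex_halfSpace_ge (dotProductEquiv ℝ (Fin n) (e + s • d - y)).isLinear s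
  refine convexHull_min ?_ hconv hq
  rintro _ ⟨t, ht, rfl⟩
  have hte : a t ⬝ᵥ e = b t := hD ht
  have hty : a t ⬝ᵥ y ≤ b t := hy t
  rw [Set.mem_ofPred_eq, dotProduct_sub, dotProduct_add, dotProduct_smul, hd t ht, hte, smul_eq_mul,
    mul_one]
  linarith

/-- The face of `F(b) ∩ span {a_t : t ∈ T}` on which all constraints indexed by `I` are active;
it supplies extreme points of the whole set at which they are active. -/
def activeFace (a : C(T, Fin n → ℝ)) (b : C(T, ℝ)) (I : Set T) : Set (Fin n → ℝ) :=
  (feasibleSet a b ∩ (Submodule.span ℝ (Set.range a) : Set (Fin n → ℝ))) ∩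
    {z | I ⊆ activeIndices a b z}

theorem isExtreme_activeFace (a : C(T, Fin n → ℝ)) (b : C(T, ℝ)) (I : Set T) :
    IsExtreme ℝ (feasibleSet a b ∩ (Submodule.span ℝ (Set.range a) : Set (Fin n → ℝ)))
      (activeFace a b I) where
  subset := Set.inter_subset_left
  left_mem_of_mem_openSegment := by
    rintro u hu v hv _ ⟨-, hz⟩ ⟨α, β, hα, hβ, hαβ, rfl⟩
    refine ⟨hu, fun t ht => (hu.1 t).antisymm (le_of_mul_le_mul_left ?_ hα)⟩
    have hzt : a t ⬝ᵥ (α • u + β • v) = b t := hz ht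
    rw [dotProduct_add, dotProduct_smul, dotProduct_smul, smul_eq_mul, smul_eq_mul] at hzt
    calc α * b t = b t - β * b t := by linear_combination b t * hαβ
      _ ≤ b t - β * (a t ⬝ᵥ v) := by gcongr; exact hv.1 t
      _ = α * (a t ⬝ᵥ u) := by linarith

theorem isClosed_activeFace (a : C(T, Fin n → ℝ)) (b : C(T, ℝ)) (I : Set T) :
    IsClosed (activeFace a b I) := by
  have hactive : IsClosed {z | I ⊆ activeIndices a b z} := by
    simp only [Set.subset_def, Set.ofPred_forall]
    exact isClosed_biInter fun t _ => isClosed_eq (by fun_prop) continuous_const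
  exact ((isClosed_feasibleSet a b).inter (Submodule.closed_of_finiteDimensional _)).inter hactive

theorem convex_activeFace (a : C(T, Fin n → ℝ)) (b : C(T, ℝ)) (I : Set T) :
    Convex ℝ (activeFace a b I) := by
  have hactive : Convex ℝ {z | I ⊆ activeIndices a b z} := by
    simp only [Set.subset_def, Set.ofPred_forall]
    exact convex_iInter₂ fun t _ =>
      convex_hyperplane (dotProductEquiv ℝ (Fin n) (a t)).isLinear (b t)
  exact ((convex_feasibleSet a b).inter (Submodule.convex _)).inter hactive

theorem exists_mem_extremeSet_activeIndices_subset {x : Fin n → ℝ} (hx : x ∈ feasibleSet a b) :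
    ∃ e ∈ extremeSet a b, activeIndices a b x ⊆ activeIndices a b e := by
  set V := Submodule.span ℝ (Set.range a)
  have hspan : ∀ t, a t ∈ V := fun t => Submodule.subset_span ⟨t, rfl⟩
  obtain ⟨y, hyV, hyx⟩ := exists_mem_forall_dotProduct_eq V x
  have hy : y ∈ activeFace a b (activeIndices a b x) :=
    ⟨⟨fun t => (hyx _ (hspan t)).trans_le (hx t), hyV⟩, fun t ht => (hyx _ (hspan t)).trans ht⟩
  obtain ⟨e, he⟩ := nonempty_extremePoints_of_forall_line (convex_activeFace a b _)
    (isClosed_activeFace a b _) ⟨y, hy⟩ fun z hz w hw => by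
      have hwV : w ∈ V := by
        simpa using V.sub_mem (hw 1).1.2 hz.1.2
      have horth := dotProduct_eq_zero_of_forall_add_smul_mem fun s => (hw s).1.1
      rw [← dotProduct_self_eq_zero, ← dotProduct_zero w]
      exact dotProduct_eq_of_mem_span (by rintro _ ⟨t, rfl⟩; simp [horth t]) hwV
  exact ⟨e, (isExtreme_activeFace a b _).extremePoints_subset_extremePoints he, he.1.2⟩

theorem IsLOP.mem_feasibleDirections (h : IsLOP a b) {x w : Fin n → ℝ} (hx : x ∈ feasibleSet a b)
    (hw : ∀ t ∈ activeIndices a b x, a t ⬝ᵥ w ≤ 0) :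
    w ∈ feasibleDirections (feasibleSet a b) x := by
  rw [h x hx]
  intro v hv
  rw [dotProduct_comm]
  exact dotProduct_nonpos_of_mem_span (by rintro _ ⟨t, ht, rfl⟩; exact hw t ht) hv

theorem IsLOP.injOn_activeIndices (h : IsLOP a b) :
    Set.InjOn (activeIndices a b) (extremeSet a b) := by
  intro e he e' he' heq
  have hdir : e - e' ∈ feasibleDirections (feasibleSet a b) e :=
    h.mem_feasibleDirections he.1.1 fun t ht => by
      have hte : a t ⬝ᵥ e = b t := ht
      have hte' : a t ⬝ᵥ e' = b t := heq.subset ht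
      rw [dotProduct_sub, hte, hte', sub_self]
  obtain ⟨ε, hε, hmem⟩ := hdir
  have hseg : e ∈ openSegment ℝ e' (e + ε • (e - e')) :=
    ⟨ε / (1 + ε), 1 / (1 + ε), by positivity, by positivity, by field_simp; ring, by
      match_scalars <;> field_simp
      ring⟩
  refine (he.2 he'.1 ⟨hmem ε ⟨hε.le, le_rfl⟩, ?_⟩ hseg).symm
  exact Submodule.add_mem _ he.1.2 (Submodule.smul_mem _ _ (Submodule.sub_mem _ he.1.2 he'.1.2))

theorem IsLOP.finite_extremeSet [Finite T] (h : IsLOP a b) : (extremeSet a b).Finite :=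
  Set.Finite.of_finite_image (Set.toFinite _) h.injOn_activeIndices

theorem IsLOP.exists_mem_feasibleSet_seminorm_sub_le [CompactSpace T]
    {p : Seminorm ℝ (Fin n → ℝ)} (hp : ∀ x, p x = 0 → x = 0) (h : IsLOP a b)
    (hb : (feasibleSet a b).Nonempty)
    (hface : ∀ e ∈ extremeSet a b, ∀ D ∈ hyperplaneFamily a b e,
      ∀ q ∈ convexHull ℝ (a '' D), ∃ x, p x < q ⬝ᵥ x)
    {x : Fin n → ℝ} {M : ℝ} (hM : 0 ≤ M) (hx : ∀ t, a t ⬝ᵥ x ≤ b t + M) :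
    ∃ y ∈ feasibleSet a b, p (x - y) ≤ M := by
  obtain ⟨y, hy, hnear⟩ := exists_forall_seminorm_sub_le hp (isClosed_feasibleSet a b) hb x
  obtain ⟨e, he, hye⟩ := exists_mem_extremeSet_activeIndices_subset hy
  obtain ⟨w, hw, hpw⟩ :
      ∃ w, (∀ s ∈ a '' activeIndices a b e, s ⬝ᵥ w ≤ 0) ∧ p (w - (x - e)) ≤ M := by
    refine exists_forall_dotProduct_nonpos_seminorm_sub_le hp (isCompact_image_activeIndices a b e)
      (fun d hd q hq => ?_) hM ?_
    · rw [Set.forall_mem_image] at hd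
      refine hface e he {t ∈ activeIndices a b e | a t ⬝ᵥ d = 1} ⟨Set.sep_subset _ _, d,
        fun t ht => ht.2, fun t ht => (hd ht.1).lt_of_ne fun htd => ht.2 ⟨ht.1, htd⟩⟩ q
        (convexHull_mono ?_ hq)
      rintro _ ⟨⟨t, ht, rfl⟩, htd⟩
      exact ⟨t, ⟨ht, htd⟩, rfl⟩
    · rintro _ ⟨t, ht, rfl⟩
      have hte : a t ⬝ᵥ e = b t := ht
      rw [dotProduct_sub, hte]
      linarith [hx t]
  have hdir : e + w - y ∈ feasibleDirections (feasibleSet a b) y :=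
    h.mem_feasibleDirections hy fun t ht => by
      have hty : a t ⬝ᵥ y = b t := ht
      have hte : a t ⬝ᵥ e = b t := hye ht
      rw [dotProduct_sub, dotProduct_add, hte, hty]
      linarith [hw _ ⟨t, hye ht, rfl⟩]
  refine ⟨y, hy, (seminorm_sub_le_of_mem_feasibleDirections hnear hdir).trans ?_⟩
  rwa [add_sub_cancel, ← sub_sub, map_sub_rev]

end FeasibleSet

section DualNorm

variable {n : ℕ} (p : Seminorm ℝ (Fin n → ℝ))

theorem dualNorm_neg (u : Fin n → ℝ) : dualNorm p (-u) = dualNorm p u := by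
  simp only [dualNorm, neg_dotProduct, abs_neg]

theorem ofReal_dotProduct_mul_inv_dualNorm_le (u x : Fin n → ℝ) :
    ENNReal.ofReal (u ⬝ᵥ x) * (dualNorm p u)⁻¹ ≤ ENNReal.ofReal (p x) := by
  have hlim : Filter.Tendsto ENNReal.ofReal (𝓝[>] p x) (𝓝 (ENNReal.ofReal (p x))) :=
    ENNReal.continuous_ofReal.continuousWithinAt
  refine ge_of_tendsto hlim (eventually_nhdsWithin_of_forall fun c hc => ?_)
  have hcpos : 0 < c := (apply_nonneg p x).trans_lt hc
  have hunit : p (c⁻¹ • x) ≤ 1 := by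
    rw [map_smul_eq_mul, norm_inv, Real.norm_of_nonneg hcpos.le]
    exact (inv_mul_le_one₀ hcpos).2 (le_of_lt hc)
  have hsup : ENNReal.ofReal (u ⬝ᵥ (c⁻¹ • x)) ≤ dualNorm p u :=
    (ENNReal.ofReal_le_ofReal (le_abs_self _)).trans
      (le_iSup₂ (f := fun x (_ : p x ≤ 1) => ENNReal.ofReal |u ⬝ᵥ x|) _ hunit)
  refine ENNReal.div_le_of_le_mul ?_
  calc ENNReal.ofReal (u ⬝ᵥ x) = ENNReal.ofReal c * ENNReal.ofReal (u ⬝ᵥ (c⁻¹ • x)) := by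
        rw [← ENNReal.ofReal_mul hcpos.le, dotProduct_smul, smul_eq_mul,
          mul_inv_cancel_left₀ hcpos.ne']
    _ ≤ ENNReal.ofReal c * dualNorm p u := by gcongr

variable {p}

theorem exists_inv_smul_seminorm_lt_dotProduct {q : Fin n → ℝ} {κ : ℝ≥0}
    (hq : (dualNorm p q)⁻¹ < κ) : ∃ x, (κ⁻¹ • p) x < q ⬝ᵥ x := by
  have hκ : κ ≠ 0 := by
    rintro rfl
    exact not_lt_zero hq
  rw [ENNReal.inv_lt_iff_inv_lt, ← ENNReal.coe_inv hκ] at hq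
  obtain ⟨x, hx⟩ := lt_iSup_iff.1 hq
  obtain ⟨hpx, hlt⟩ := lt_iSup_iff.1 hx
  rw [ENNReal.lt_ofReal_iff_toReal_lt ENNReal.coe_ne_top, ENNReal.coe_toReal] at hlt
  have hle : (κ⁻¹ • p) x < |q ⬝ᵥ x| := (mul_le_of_le_one_right κ⁻¹.2 hpx).trans_lt hlt
  rcases abs_choice (q ⬝ᵥ x) with habs | habs
  · exact ⟨x, habs ▸ hle⟩
  · exact ⟨-x, by rwa [map_neg_eq_map, dotProduct_neg, ← habs]⟩

end DualNorm

section NormMetric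

variable {n : ℕ} (p : Seminorm ℝ (Fin n → ℝ))

theorem edist_normMetric (x y : Fin n → ℝ) :
    @edist _ (normMetric p).toEDist x y = ENNReal.ofReal (p (x - y)) := by
  have hdist : @dist _ (normMetric p).toDist y x = p (-y + x) := rfl
  rw [@edist_comm _ (normMetric p).toPseudoEMetricSpace, @edist_dist _ (normMetric p), hdist,
    sub_eq_neg_add]

theorem infEDist_normMetric (x : Fin n → ℝ) (F : Set (Fin n → ℝ)) :
    @Metric.infEDist _ (normMetric p).toPseudoEMetricSpace x F =
      ⨅ y ∈ F, ENNReal.ofReal (p (x - y)) := by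
  simp only [Metric.infEDist, edist_normMetric]

theorem tendsto_add_smul_nhds_normMetric (x v : Fin n → ℝ) :
    Filter.Tendsto (fun s : ℝ => x + s • v) (𝓝 0)
      (@nhds _ (normMetric p).toUniformSpace.toTopologicalSpace x) := by
  refine (@tendsto_iff_edist_tendsto_0 _ _ (normMetric p).toPseudoEMetricSpace _ _ _).2 ?_
  have hcont : Continuous fun s : ℝ => ENNReal.ofReal (‖s‖ * p v) :=
    ENNReal.continuous_ofReal.comp (by fun_prop)
  simpa only [edist_normMetric, add_sub_cancel_left, map_smul_eq_mul, norm_zero, zero_mul,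
    ENNReal.ofReal_zero] using hcont.tendsto 0

end NormMetric

section Moduli

variable {n : ℕ} {T : Type*} [TopologicalSpace T] [CompactSpace T] {p : Seminorm ℝ (Fin n → ℝ)}
  {a : C(T, Fin n → ℝ)} {b : C(T, ℝ)}

theorem infEDist_setOf_mem_feasibleSet_le {x : Fin n → ℝ} {M : ℝ} (hM : 0 ≤ M)
    (hx : ∀ t, a t ⬝ᵥ x ≤ b t + M) :
    Metric.infEDist b {b' | x ∈ feasibleSet a b'} ≤ ENNReal.ofReal M := by
  have hmem : b + ContinuousMap.const T M ∈ {b' | x ∈ feasibleSet a b'} := hx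
  refine (Metric.infEDist_le_edist_of_mem hmem).trans ?_
  rw [edist_dist]
  refine ENNReal.ofReal_le_ofReal ((ContinuousMap.dist_le hM).2 fun t => ?_)
  simp [abs_of_nonneg hM]

theorem dotProduct_le_add_dist_of_mem_feasibleSet {b' : C(T, ℝ)} {x : Fin n → ℝ}
    (hx : x ∈ feasibleSet a b') (t : T) : a t ⬝ᵥ x ≤ b t + dist b b' := by
  have hdist := ContinuousMap.dist_apply_le_dist (f := b) (g := b') t
  rw [Real.dist_eq, abs_sub_comm] at hdist
  have hxt : a t ⬝ᵥ x ≤ b' t := hx t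
  linarith [le_abs_self (b' t - b t)]

theorem clmF_le_hofF (p : Seminorm ℝ (Fin n → ℝ)) (a : C(T, Fin n → ℝ)) (b : C(T, ℝ))
    (x : Fin n → ℝ) : clmF p a b x ≤ hofF p a b :=
  le_iInf₂ fun κ hκ => iInf₂_le κ (Filter.Eventually.of_forall hκ)

theorem eventually_forall_dotProduct_add_smul_le {e d : Fin n → ℝ} (he : e ∈ feasibleSet a b)
    {c : ℝ} (hd : ∀ t ∈ activeIndices a b e, a t ⬝ᵥ d < c) :
    ∀ᶠ s in 𝓝[>] (0 : ℝ), ∀ t, a t ⬝ᵥ (e + s • d) ≤ b t + s * c := by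
  have hsmall := eventually_forall_add_mul_neg (isCompact_univ (X := T))
    (g := fun t => a t ⬝ᵥ e - b t) (h := fun t => a t ⬝ᵥ d - c)
    (by fun_prop) (by fun_prop) (fun t _ => sub_nonpos.2 (he t))
    fun t _ ht => sub_neg.2 (hd t (sub_eq_zero.1 ht))
  filter_upwards [hsmall] with s hs t
  rw [dotProduct_add, dotProduct_smul, smul_eq_mul]
  linarith [hs t trivial]

theorem inv_dualDist_le_clmF {e : Fin n → ℝ} (he : e ∈ feasibleSet a b) {D : Set T}
    (hD : D ∈ hyperplaneFamily a b e) :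
    (dualDist p 0 (convexHull ℝ (a '' D)))⁻¹ ≤ clmF p a b e := by
  refine le_iInf₂ fun κ hκ => ENNReal.inv_le_iff_inv_le.2 (le_iInf₂ fun q hq => ?_)
  rw [zero_sub, dualNorm_neg, ENNReal.inv_le_iff_inv_le]
  obtain ⟨hDe, d, hd, hd'⟩ := hD
  have hlim : Filter.Tendsto (fun c => κ * ENNReal.ofReal c) (𝓝[>] 1) (𝓝 κ) := by
    have hcont : Continuous fun c => κ * ENNReal.ofReal c :=
      (ENNReal.continuous_const_mul ENNReal.coe_ne_top).comp ENNReal.continuous_ofReal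
    simpa using (hcont.tendsto 1).mono_left nhdsWithin_le_nhds
  refine ge_of_tendsto hlim (eventually_nhdsWithin_of_forall fun c (hc : 1 < c) => ?_)
  have hactive : ∀ t ∈ activeIndices a b e, a t ⬝ᵥ d < c := fun t ht => by
    by_cases htD : t ∈ D
    · exact (hd t htD).trans_lt hc
    · exact (hd' t ⟨ht, htD⟩).trans hc
  obtain ⟨s, ⟨hcalm, hle⟩, hs⟩ :=
    ((((tendsto_add_smul_nhds_normMetric p e d).mono_left nhdsWithin_le_nhds).eventually hκ).and
      (eventually_forall_dotProduct_add_smul_le he hactive)).and self_mem_nhdsWithin |>.exists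
  have hs : 0 < s := hs
  have hlower : ENNReal.ofReal s * (dualNorm p q)⁻¹ ≤
      @Metric.infEDist _ (normMetric p).toPseudoEMetricSpace (e + s • d) (feasibleSet a b) := by
    rw [infEDist_normMetric]
    refine le_iInf₂ fun y hy => le_trans ?_ (ofReal_dotProduct_mul_inv_dualNorm_le p q _)
    gcongr
    exact le_dotProduct_of_mem_convexHull hDe hd hq hy s
  have hupper := infEDist_setOf_mem_feasibleSet_le (by positivity) hle
  refine (ENNReal.mul_le_mul_iff_right (ENNReal.ofReal_pos.2 hs).ne' ENNReal.ofReal_ne_top).1 ?_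
  calc ENNReal.ofReal s * (dualNorm p q)⁻¹ ≤ κ * ENNReal.ofReal (s * c) :=
        hlower.trans (hcalm.trans (by gcongr))
    _ = ENNReal.ofReal s * (κ * ENNReal.ofReal c) := by
      rw [ENNReal.ofReal_mul hs.le, mul_left_comm]

theorem IsLOP.hofF_le (h : IsLOP a b) (hp : ∀ x, p x = 0 → x = 0)
    (hb : (feasibleSet a b).Nonempty) {κ : ℝ≥0} (hκ : κ ≠ 0)
    (hbound : ∀ e ∈ extremeSet a b, ∀ D ∈ hyperplaneFamily a b e,
      (dualDist p 0 (convexHull ℝ (a '' D)))⁻¹ < κ) :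
    hofF p a b ≤ κ := by
  have hface : ∀ e ∈ extremeSet a b, ∀ D ∈ hyperplaneFamily a b e,
      ∀ q ∈ convexHull ℝ (a '' D), ∃ x, (κ⁻¹ • p) x < q ⬝ᵥ x := fun e he D hD q hq => by
    refine exists_inv_smul_seminorm_lt_dotProduct ((ENNReal.inv_le_inv.2 ?_).trans_lt
      (hbound e he D hD))
    rw [← dualNorm_neg, ← zero_sub]
    exact iInf₂_le q hq
  have hpκ : ∀ x, (κ⁻¹ • p) x = 0 → x = 0 := fun x hx =>
    hp x ((smul_eq_zero_iff_right (inv_ne_zero hκ)).1 hx)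
  refine iInf₂_le κ fun x => ?_
  rw [mul_comm, ← ENNReal.div_le_iff (ENNReal.coe_ne_zero.2 hκ) ENNReal.coe_ne_top,
    Metric.le_infEDist]
  intro b' hb'
  obtain ⟨y, hy, hxy⟩ := h.exists_mem_feasibleSet_seminorm_sub_le hpκ hb hface dist_nonneg
    (dotProduct_le_add_dist_of_mem_feasibleSet (b := b) hb')
  have hle : p (x - y) ≤ dist b b' * κ :=
    (inv_mul_le_iff₀' (NNReal.coe_pos.2 (pos_iff_ne_zero.2 hκ))).1 hxy
  refine ENNReal.div_le_of_le_mul ?_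
  calc @Metric.infEDist _ (normMetric p).toPseudoEMetricSpace x (feasibleSet a b)
      ≤ ENNReal.ofReal (p (x - y)) := (infEDist_normMetric p x _).trans_le (iInf₂_le y hy)
    _ ≤ ENNReal.ofReal (dist b b' * κ) := ENNReal.ofReal_le_ofReal hle
    _ = edist b b' * κ := by
      rw [ENNReal.ofReal_mul dist_nonneg, ENNReal.ofReal_coe_nnreal, edist_dist]

theorem IsLOP.hofF_eq_iSup_inv_dualDist (h : IsLOP a b) (hp : ∀ x, p x = 0 → x = 0)
    (hb : (feasibleSet a b).Nonempty) :
    hofF p a b = ⨆ x ∈ extremeSet a b, ⨆ D ∈ hyperplaneFamily a b x,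
      (dualDist p 0 (convexHull ℝ (a '' D)))⁻¹ := by
  refine le_antisymm (le_of_forall_gt_imp_ge_of_dense fun c hc => ?_) <|
    iSup₂_le fun x hx => iSup₂_le fun D hD =>
      (inv_dualDist_le_clmF hx.1.1 hD).trans (clmF_le_hofF p a b x)
  obtain ⟨κ, hκ, hκc⟩ := ENNReal.lt_iff_exists_nnreal_btwn.1 hc
  refine (h.hofF_le hp hb (ENNReal.coe_ne_zero.1 hκ.ne_bot) fun x hx D hD => ?_).trans hκc.le
  exact (le_iSup₂_of_le x hx (le_iSup₂ (f := fun D (_ : D ∈ hyperplaneFamily a b x) =>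
    (dualDist p 0 (convexHull ℝ (a '' D)))⁻¹) D hD)).trans_lt hκ

theorem IsLOP.hofF_eq_iSup_clmF (h : IsLOP a b) (hp : ∀ x, p x = 0 → x = 0)
    (hb : (feasibleSet a b).Nonempty) : hofF p a b = ⨆ x ∈ extremeSet a b, clmF p a b x := by
  refine le_antisymm ?_ (iSup₂_le fun x _ => clmF_le_hofF p a b x)
  rw [h.hofF_eq_iSup_inv_dualDist hp hb]
  exact iSup₂_mono fun x hx => iSup₂_le fun D hD => inv_dualDist_le_clmF hx.1.1 hD

end Moduli

end LinSys

theorem mainTheorem3_general {n : ℕ} {T : Type*} [TopologicalSpace T] [CompactSpace T]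
    (p : Seminorm ℝ (Fin n → ℝ)) (hp : ∀ x, p x = 0 → x = 0)
    (a : C(T, Fin n → ℝ)) (b : C(T, ℝ))
    (hb : (LinSys.feasibleSet a b).Nonempty) (hLOP : LinSys.IsLOP a b) :
    (LinSys.hofF p a b = ⨆ x ∈ LinSys.extremeSet a b, LinSys.clmF p a b x) ∧
    (LinSys.hofF p a b = ⨆ x ∈ LinSys.extremeSet a b, ⨆ D ∈ LinSys.hyperplaneFamily a b x,
      (LinSys.dualDist p 0 (convexHull ℝ (a '' D)))⁻¹) ∧
    (Finite T →
      (LinSys.extremeSet a b).Finite ∧ (LinSys.extremeSet a b).Nonempty ∧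
      (∀ x ∈ LinSys.extremeSet a b,
        (LinSys.hyperplaneFamily a b x).Finite ∧ (LinSys.hyperplaneFamily a b x).Nonempty) ∧
      (∃ x ∈ LinSys.extremeSet a b, LinSys.hofF p a b = LinSys.clmF p a b x) ∧
      (∃ x ∈ LinSys.extremeSet a b, ∃ D ∈ LinSys.hyperplaneFamily a b x,
        LinSys.hofF p a b = (LinSys.dualDist p 0 (convexHull ℝ (a '' D)))⁻¹)) := by
  have hclm := hLOP.hofF_eq_iSup_clmF hp hb
  have hdual := hLOP.hofF_eq_iSup_inv_dualDist hp hb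
  refine ⟨hclm, hdual, fun _ => ?_⟩
  have hEfin := hLOP.finite_extremeSet
  obtain ⟨x₀, hx₀⟩ := hb
  obtain ⟨e, he, -⟩ := LinSys.exists_mem_extremeSet_activeIndices_subset hx₀
  have hDne : ∀ x, (LinSys.hyperplaneFamily a b x).Nonempty := fun x =>
    ⟨∅, LinSys.empty_mem_hyperplaneFamily a b x⟩
  refine ⟨hEfin, ⟨e, he⟩, fun x _ => ⟨Set.toFinite _, hDne x⟩, ?_, ?_⟩
  · obtain ⟨x, hx, hmax⟩ := Set.Nonempty.ciSup_mem_image (LinSys.clmF p a b) ⟨e, he⟩ hEfin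
    exact ⟨x, hx, hclm.trans hmax.symm⟩
  · obtain ⟨x, hx, hmax⟩ := Set.Nonempty.ciSup_mem_image (fun x =>
      ⨆ D ∈ LinSys.hyperplaneFamily a b x, (LinSys.dualDist p 0 (convexHull ℝ (a '' D)))⁻¹)
      ⟨e, he⟩ hEfin
    obtain ⟨D, hD, hmaxD⟩ := (hDne x).ciSup_mem_image
      (fun D => (LinSys.dualDist p 0 (convexHull ℝ (a '' D)))⁻¹) (Set.toFinite _)
    exact ⟨x, hx, D, hD, hdual.trans (hmax.symm.trans hmaxD.symm)⟩

theorem mainTheorem3 {n : ℕ} {T : Type*} [TopologicalSpace T] [CompactSpace T] [T2Space T]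
    (p : Seminorm ℝ (Fin n → ℝ)) (hp : ∀ x, p x = 0 → x = 0)
    (a : C(T, Fin n → ℝ)) (b : C(T, ℝ))
    (hb : (LinSys.feasibleSet a b).Nonempty) (hLOP : LinSys.IsLOP a b) :
    (LinSys.hofF p a b = ⨆ x ∈ LinSys.extremeSet a b, LinSys.clmF p a b x) ∧
    (LinSys.hofF p a b = ⨆ x ∈ LinSys.extremeSet a b, ⨆ D ∈ LinSys.hyperplaneFamily a b x,
      (LinSys.dualDist p 0 (convexHull ℝ (a '' D)))⁻¹) ∧
    (Finite T →
      (LinSys.extremeSet a b).Finite ∧ (LinSys.extremeSet a b).Nonempty ∧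
      (∀ x ∈ LinSys.extremeSet a b,
        (LinSys.hyperplaneFamily a b x).Finite ∧ (LinSys.hyperplaneFamily a b x).Nonempty) ∧
      (∃ x ∈ LinSys.extremeSet a b, LinSys.hofF p a b = LinSys.clmF p a b x) ∧
      (∃ x ∈ LinSys.extremeSet a b, ∃ D ∈ LinSys.hyperplaneFamily a b x,
        LinSys.hofF p a b = (LinSys.dualDist p 0 (convexHull ℝ (a '' D)))⁻¹)) :=
  mainTheorem3_general p hp a b hb hLOP
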